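/- All spaces are locally compact Hausdorff. Write $K\in\mathcal K_{I}$ if $K$ is $\sigma$-compact; $K\in\mathcal K_{II}$ if $K$ is not $\sigma$-compact but has a dense $\sigma$-compact subset; $K\in\mathcal K_{III}$ if the complement of every $\sigma$-compact subset of $K$ has an interior point and some $\sigma$-compact subset of $K$ is not precompact; $K\in\mathcal K_{IV}$ if the complement of every $\sigma$-compact subset has an interior point and every $\sigma$-compact subset is precompact. The $C^*$-algebra $C_0(K)$ of complex continuous functions vanishing at infinity is regarded as a Hilbert module over itself with $\langle x,y\rangle=\bar x y$; $C_b(K)$ is the algebra of bounded continuous functions, and $\langle x,y\rangle=\bar x y\in C_0(K)$ also for $x\in C_0(K)$, $y\in C_b(K)$. An operator on $C_0(K)$ is a bounded $C_0(K)$-homomorphism $F$; it is adjointable if there is an operator $F^*$ with $\langle Fx,y\rangle=\langle x,F^*y\rangle$ for all $x,y$, and $C_0(K)$-compact if it lies in the norm closure of the linear span of the operators $\theta_{x,y}(z)=x\langle y,z\rangle$. A sequence $X=(x_i)$ in $C_b(K)$ is admissible if $\|x_i\|\le1$ for all $i$ and, for every $x\in C_0(K)$, the series $\sum_i\langle x,x_i\rangle\langle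 x_i,x\rangle$ converges in norm with sum at most $\langle x,x\rangle$. A set $Y\subseteq C_0(K)$ is $(C_b(K),C_0(K))$-totally bounded if for every admissible $X$, every sequence $\Phi=(\varphi_k)$ of states of $C_0(K)$ and every $\varepsilon>0$ there is a finite $\varepsilon$-net in $Y$ for the pseudometric $d_{X,\Phi}(x,y)=\bigl(\sup_k\sum_{i\ge k}|\varphi_k(\langle x-y,x_i\rangle)|^2\bigr)^{1/2}$. For non-compact $K$, let $\dot C_0(K)$ be the unitization of $C_0(K)$. A frame in $C_0(K)$ is a family $(x_j)_{j\in J}$ in $C_0(K)$, indexed by any set $J$, for which there are constants $c_1,c_2>0$ such that for every $x\in C_0(K)$ the series $\sum_j\langle x,x_j\rangle\langle x_j,x\rangle$ converges and $c_1\langle x,x\rangle\le\sum_j\langle x,x_j\rangle\langle x_j,x\rangle\le c_2\langle x,x\rangle$, where the convergence is either in the norm of $\dot C_0(K)$ (standard frame) or, for the net of finite partial sums, in the ultraweak topology of the universal enveloping von Neumann algebra of $\dot C_0(K)$, to an element of that algebra (non-standard frame). **Theorem.** Let $K=P_1\sqcup P_2$ with $P_1\in\mathcal K_{IV}$ and $P_2\in\mathcal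 K_{I}\cup\mathcal K_{II}\cup\mathcal K_{III}$. If $P_2$ is not compact, then $K\in\mathcal K_{III}$. Let $F:C_0(K)\to C_0(K)$ be multiplication by the indicator function of $P_1$. Then 1. $F$ is an adjointable operator; 2. $F$ is not $C_0(K)$-compact; 3. the image under $F$ of the closed unit ball of $C_0(K)$ is $(C_b(K),C_0(K))$-totally bounded; 4. $C_0(K)$ has no frames, neither standard nor non-standard. -/

import Mathlib

open Filter Topology Set
open scoped ZeroAtInfty ComplexOrder BoundedContinuousFunction InnerProductSpace CStarAlgebra ENNReal

noncomputable section

namespace CStarFrames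

/-! ### Classes of locally compact Hausdorff spaces -/

/-- `𝒦_I`: the `σ`-compact locally compact Hausdorff spaces. -/
def ClassI (K : Type*) [TopologicalSpace K] : Prop :=
  LocallyCompactSpace K ∧ T2Space K ∧ SigmaCompactSpace K

/-- `𝒦_II`: not `σ`-compact, but with a dense `σ`-compact subset. -/
def ClassII (K : Type*) [TopologicalSpace K] : Prop :=
  LocallyCompactSpace K ∧ T2Space K ∧ ¬ SigmaCompactSpace K ∧
    ∃ s : Set K, IsSigmaCompact s ∧ Dense s

/-- `𝒦_III`: the complement of every `σ`-compact subset has an interior point, and some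
`σ`-compact subset is not precompact. -/
def ClassIII (K : Type*) [TopologicalSpace K] : Prop :=
  LocallyCompactSpace K ∧ T2Space K ∧
    (∀ s : Set K, IsSigmaCompact s → (interior sᶜ).Nonempty) ∧
    ∃ s : Set K, IsSigmaCompact s ∧ ¬ IsCompact (closure s)

/-- `𝒦_IV`: the complement of every `σ`-compact subset has an interior point, and every
`σ`-compact subset is precompact. -/
def ClassIV (K : Type*) [TopologicalSpace K] : Prop :=
  LocallyCompactSpace K ∧ T2Space K ∧
    (∀ s : Set K, IsSigmaCompact s → (interior sᶜ).Nonempty) ∧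
    ∀ s : Set K, IsSigmaCompact s → IsCompact (closure s)

/-! ### A `C⋆`-algebra as a right Hilbert module over itself

The inner product is `⟨x, y⟩ = x⋆ y`, and `A` acts by multiplication from the right. -/

section Operators

variable {A : Type*} [NonUnitalCStarAlgebra A]

/-- An operator in the sense of Hilbert `C⋆`-modules: a bounded `A`-homomorphism. -/
def IsModuleOperator (F : A →L[ℂ] A) : Prop :=
  ∀ x a : A, F (x * a) = F x * a

/-- `F` is an operator which has an adjoint `G`, that is `⟨F x, y⟩ = ⟨x, G y⟩`. -/
def IsAdjointable (F : A →L[ℂ] A) : Prop :=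
  IsModuleOperator F ∧
    ∃ G : A →L[ℂ] A, IsModuleOperator G ∧ ∀ x y : A, star (F x) * y = star x * G y

/-- The elementary `A`-compact operator `θ_{x,y}(z) = x ⟨y, z⟩`. -/
def theta (x y : A) : A →L[ℂ] A :=
  ContinuousLinearMap.mul ℂ A x ∘L ContinuousLinearMap.mul ℂ A (star y)

theorem theta_apply (x y z : A) : theta x y z = x * (star y * z) := rfl

/-- `F` is `A`-compact: it lies in the operator norm closure of the linear span of the elementary
`A`-compact operators. -/
def IsACompact (F : A →L[ℂ] A) : Prop :=
  F ∈ closure (Submodule.span ℂ {T : A →L[ℂ] A | ∃ x y : A, T = theta x y} : Set (A →L[ℂ] A))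

/-- A state: a positive linear functional of norm one. -/
def IsState (φ : A →L[ℂ] ℂ) : Prop :=
  (∀ a : A, 0 ≤ φ (star a * a)) ∧ ‖φ‖ = 1

end Operators

/-! ### The universal enveloping von Neumann algebra of a unital `C⋆`-algebra -/

section Enveloping

variable (B : Type*) [CStarAlgebra B] [PartialOrder B] [StarOrderedRing B]

/-- The states of a unital `C⋆`-algebra, as positive functionals taking the value `1` at `1`. -/
abbrev UnitalState : Type _ := {f : B →ₚ[ℂ] ℂ // f 1 = 1}

/-- The space of the universal representation: the Hilbert sum of the GNS spaces of all states. -/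
abbrev UniversalSpace : Type _ := lp (fun f : UnitalState B => f.1.GNS) 2

variable {B}

/-- The direct sum of the operators by which `b` acts on the GNS spaces of all states. -/
def universalOperator (b : B) : UniversalSpace B →L[ℂ] UniversalSpace B :=
  lp.mapCLM 2 (fun f : UnitalState B => f.1.gnsStarAlgHom b) (norm_nonneg b)
    (fun f => NonUnitalStarAlgHom.norm_apply_le f.1.gnsStarAlgHom b)

theorem universalOperator_apply (b : B) (ξ : UniversalSpace B) (f : UnitalState B) :
    universalOperator b ξ f = f.1.gnsStarAlgHom b (ξ f) := rfl

/-- The universal representation: the direct sum of the GNS representations of all states. -/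
def universalRep : B →⋆ₐ[ℂ] (UniversalSpace B →L[ℂ] UniversalSpace B) where
  toFun := universalOperator
  map_one' := by ext ξ f; simp [universalOperator_apply]
  map_mul' a b := by ext ξ f; simp [universalOperator_apply]
  map_zero' := by ext ξ f; simp [universalOperator_apply]
  map_add' a b := by ext ξ f; simp [universalOperator_apply]
  commutes' r := by
    ext ξ f; simp [universalOperator_apply, Algebra.algebraMap_eq_smul_one]
  map_star' a := by
    refine (ContinuousLinearMap.eq_adjoint_iff _ _).2 fun x y => ?_
    rw [lp.inner_eq_tsum, lp.inner_eq_tsum]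
    congr 1; ext f
    rw [universalOperator_apply, universalOperator_apply, map_star]
    exact ContinuousLinearMap.adjoint_inner_left _ _ _

theorem universalRep_apply (b : B) (ξ : UniversalSpace B) (f : UnitalState B) :
    universalRep b ξ f = f.1.gnsStarAlgHom b (ξ f) := rfl

variable (B) in
/-- The universal enveloping von Neumann algebra `B''`: the bicommutant of the image of the
universal representation. -/
def envelopingAlgebra : Set (UniversalSpace B →L[ℂ] UniversalSpace B) :=
  Set.centralizer (Set.centralizer (Set.range (universalRep : B → UniversalSpace B →L[ℂ] UniversalSpace B)))

end Enveloping

/-- Convergence of a net of bounded operators in the ultraweak (`σ`-weak) topology, which is given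
by the functionals `T ↦ ∑ₙ ⟨ξₙ, T ηₙ⟩` with `∑ₙ ‖ξₙ‖² < ∞` and `∑ₙ ‖ηₙ‖² < ∞`. -/
def UltraweakTendsto {H : Type*} [NormedAddCommGroup H] [InnerProductSpace ℂ H] {ι : Type*}
    (S : ι → H →L[ℂ] H) (l : Filter ι) (T : H →L[ℂ] H) : Prop :=
  ∀ ξ η : ℕ → H, Summable (fun n => ‖ξ n‖ ^ 2) → Summable (fun n => ‖η n‖ ^ 2) →
    Tendsto (fun i => ∑' n, ⟪ξ n, S i (η n)⟫_ℂ) l (𝓝 (∑' n, ⟪ξ n, T (η n)⟫_ℂ))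

/-! ### Frames

The algebra `A` is regarded as a Hilbert module over its unitization `A⁺¹`. -/

section Frames

variable {A : Type*} [NonUnitalCStarAlgebra A] [PartialOrder A] [StarOrderedRing A]

/-- The term `⟨x, y⟩⟨y, x⟩`, as an element of the unitization. -/
def frameTerm (x y : A) : A⁺¹ := (((star x * y) * (star y * x) : A) : A⁺¹)

/-- The square `⟨x, x⟩`, as an element of the unitization. -/
def innerSelf (x : A) : A⁺¹ := ((star x * x : A) : A⁺¹)

/-- Standard frames: the series `∑ⱼ ⟨x, xⱼ⟩⟨xⱼ, x⟩` converges in norm, and its sum lies between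
`c₁⟨x, x⟩` and `c₂⟨x, x⟩`. -/
def IsStandardFrame {J : Type*} (u : J → A) : Prop :=
  ∃ c₁ c₂ : ℝ, 0 < c₁ ∧ 0 < c₂ ∧ ∀ x : A, ∃ s : A⁺¹,
    HasSum (fun j => frameTerm x (u j)) s ∧
    (c₁ : ℂ) • innerSelf x ≤ s ∧ s ≤ (c₂ : ℂ) • innerSelf x

/-- Non-standard frames: the net of finite partial sums of `∑ⱼ ⟨x, xⱼ⟩⟨xⱼ, x⟩` converges
ultraweakly to an element of the universal enveloping von Neumann algebra of `A⁺¹`, which lies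
between `c₁⟨x, x⟩` and `c₂⟨x, x⟩`. -/
def IsNonstandardFrame {J : Type*} (u : J → A) : Prop :=
  ∃ c₁ c₂ : ℝ, 0 < c₁ ∧ 0 < c₂ ∧ ∀ x : A, ∃ T ∈ envelopingAlgebra A⁺¹,
    UltraweakTendsto (fun s : Finset J => universalRep (∑ j ∈ s, frameTerm x (u j))) atTop T ∧
    (c₁ : ℂ) • universalRep (innerSelf x) ≤ T ∧ T ≤ (c₂ : ℂ) • universalRep (innerSelf x)

/-- A frame is a family which is a standard or a non-standard frame. -/
def IsFrame {J : Type*} (u : J → A) : Prop :=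
  IsStandardFrame u ∨ IsNonstandardFrame u

end Frames

/-! ### The algebra `C₀(K)` and its multipliers `C_b(K)` -/

section FunctionAlgebra

variable {K : Type*} [TopologicalSpace K]

/-- The pointwise order on `C₀(K)`. -/
instance instPartialOrderC₀ : PartialOrder C₀(K, ℂ) :=
  PartialOrder.lift (fun f : C₀(K, ℂ) => (f : K → ℂ)) DFunLike.coe_injective

theorem C₀_le_def (f g : C₀(K, ℂ)) : f ≤ g ↔ ∀ t, f t ≤ g t := Iff.rfl

/-- The pointwise order is the order of the `C⋆`-algebra `C₀(K)`. -/
instance instStarOrderedRingC₀ : StarOrderedRing C₀(K, ℂ) :=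
  StarOrderedRing.of_nonneg_iff'
    (fun {x y} hxy z t => by simpa using hxy t)
    (fun x => by
      constructor
      · intro hx
        have hx' : ∀ t, 0 ≤ x t := fun t => by simpa using hx t
        refine ⟨⟨⟨fun t => ((Real.sqrt ‖x t‖ : ℝ) : ℂ), by fun_prop⟩, ?_⟩, ?_⟩
        · have h := x.zero_at_infty'
          have h2 : Continuous (fun z : ℂ => ((Real.sqrt ‖z‖ : ℝ) : ℂ)) := by fun_prop
          have h3 := h2.tendsto 0
          simp only [norm_zero, Real.sqrt_zero, Complex.ofReal_zero] at h3
          exact h3.comp h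
        · ext t
          change x t = star ((Real.sqrt ‖x t‖ : ℝ) : ℂ) * ((Real.sqrt ‖x t‖ : ℝ) : ℂ)
          rw [Complex.star_def, Complex.conj_ofReal, ← Complex.ofReal_mul,
            Real.mul_self_sqrt (norm_nonneg _)]
          exact Complex.eq_coe_norm_of_nonneg (hx' t)
      · rintro ⟨s, rfl⟩ t
        exact star_mul_self_nonneg (s t))

/-- The product of a bounded continuous function and a function vanishing at infinity. -/
def bmul (b : K →ᵇ ℂ) (f : C₀(K, ℂ)) : C₀(K, ℂ) where
  toFun t := b t * f t
  continuous_toFun := b.continuous.mul f.1.continuous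
  zero_at_infty' := by
    refine squeeze_zero_norm (a := fun t => ‖b‖ * ‖f t‖) (fun t => ?_) ?_
    · rw [norm_mul]
      exact mul_le_mul_of_nonneg_right (b.norm_coe_le_norm t) (norm_nonneg _)
    · have h := (f.zero_at_infty'.norm).const_mul ‖b‖
      simpa using h

theorem bmul_apply (b : K →ᵇ ℂ) (f : C₀(K, ℂ)) (t : K) : bmul b f t = b t * f t := rfl

/-- The operator on `C₀(K)` of multiplication by a bounded continuous function. -/
def mulOperator (b : K →ᵇ ℂ) : C₀(K, ℂ) →L[ℂ] C₀(K, ℂ) :=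
  LinearMap.mkContinuous
    { toFun := bmul b
      map_add' := fun f g => by ext t; simp [bmul_apply, mul_add]
      map_smul' := fun c f => by ext t; simp [bmul_apply, mul_left_comm] }
    ‖b‖ (fun f => by
      change ‖(bmul b f).toBCF‖ ≤ ‖b‖ * ‖f.toBCF‖
      refine (BoundedContinuousFunction.norm_le (by positivity)).2 fun t => ?_
      change ‖b t * f t‖ ≤ _
      rw [norm_mul]
      exact mul_le_mul (b.norm_coe_le_norm t) (f.toBCF.norm_coe_le_norm t) (norm_nonneg _)
        (norm_nonneg _))

theorem mulOperator_apply (b : K →ᵇ ℂ) (f : C₀(K, ℂ)) (t : K) :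
    mulOperator b f t = b t * f t := rfl

/-- The inner product `⟨x, y⟩ = x̄ y ∈ C₀(K)` of `x ∈ C₀(K)` and `y ∈ C_b(K)`. -/
def innerMultiplier (x : C₀(K, ℂ)) (y : K →ᵇ ℂ) : C₀(K, ℂ) := bmul y (star x)

theorem innerMultiplier_apply (x : C₀(K, ℂ)) (y : K →ᵇ ℂ) (t : K) :
    innerMultiplier x y t = y t * star (x t) := rfl

/-- A sequence `X` in `C_b(K)` is (outer) admissible for `C₀(K)`: for every `x ∈ C₀(K)` the series
`∑ᵢ ⟨x, xᵢ⟩⟨xᵢ, x⟩` converges in norm to an element that is at most `⟨x, x⟩`, and `‖xᵢ‖ ≤ 1`.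
Finite systems are covered by adding zeros; note that `⟨xᵢ, x⟩ = ⟨x, xᵢ⟩⋆`. -/
def IsAdmissible (X : ℕ → K →ᵇ ℂ) : Prop :=
  (∀ x : C₀(K, ℂ), ∃ s : C₀(K, ℂ),
    Tendsto (fun n => ∑ i ∈ Finset.range n, innerMultiplier x (X i) * star (innerMultiplier x (X i)))
      atTop (𝓝 s) ∧ s ≤ star x * x) ∧
  ∀ i, ‖X i‖ ≤ 1

/-- The seminorm `ν_{X,Φ}(x) = (sup_k ∑_{i ≥ k} |φ_k(⟨x, x_i⟩)|²)^{1/2}`, with values in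
`[0, ∞]`. -/
def nu (X : ℕ → K →ᵇ ℂ) (Φ : ℕ → C₀(K, ℂ) →L[ℂ] ℂ) (x : C₀(K, ℂ)) : ℝ≥0∞ :=
  (⨆ k : ℕ, ∑' i : ℕ, ‖Φ k (innerMultiplier x (X (k + i)))‖ₑ ^ 2) ^ (1 / 2 : ℝ)

/-- `Y ⊆ C₀(K)` is `(C_b(K), C₀(K))`-totally bounded: for every admissible `X`, every sequence `Φ`
of states and every `ε > 0` there is a finite `ε`-net in `Y` for `d_{X,Φ}(x, y) = ν_{X,Φ}(x - y)`. -/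
def IsOuterTotallyBounded (Y : Set C₀(K, ℂ)) : Prop :=
  ∀ (X : ℕ → K →ᵇ ℂ) (Φ : ℕ → C₀(K, ℂ) →L[ℂ] ℂ), IsAdmissible X → (∀ k, IsState (Φ k)) →
    ∀ ε : ℝ, 0 < ε → ∃ N : Set C₀(K, ℂ), N.Finite ∧ N ⊆ Y ∧
      ∀ y ∈ Y, ∃ z ∈ N, nu X Φ (z - y) < ENNReal.ofReal ε

end FunctionAlgebra

/-- The indicator function of the first summand of a disjoint union, in `C_b(P₁ ⊔ P₂)`. -/
def indicatorInl (P₁ P₂ : Type*) [TopologicalSpace P₁] [TopologicalSpace P₂] : (P₁ ⊕ P₂) →ᵇ ℂ :=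
  BoundedContinuousFunction.ofNormedAddCommGroup
    (Sum.elim (fun _ => 1) (fun _ => 0)) (continuous_const.sumElim continuous_const) 1
    (by rintro (t | t) <;> simp)

end CStarFrames

end

/-!
Every function in `C₀(K)`, and every bounded functional on `C₀(K)`, lives on a `σ`-compact set.

For `F` the contrast between compactness and total boundedness comes from this. An operator is
`C₀(K)`-compact only if it is a limit of multiplications by elements of `C₀(K)`, which the indicator
function of the noncompact clopen set `P₁` is not. But a sequence of states meets `P₁` in a
precompact set, so the states cannot tell `y` from `e * y` for some `e ∈ C₀(K)` and all `y` in the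
image of `F`. As `∑ᵢ |xᵢ|² |e|²` converges uniformly, the tails of the seminorm `ν_{X,Φ}` are
uniformly small on the image of the ball, and only finitely many functionals matter.

A frame, evaluated at the points of `P₁`, yields a point-countable cover of `P₁` by open `σ`-compact
sets. Inductively choose `pₙ` outside all members of the cover which contain an earlier point. The
member around a cluster point of this sequence contains two of the `pₙ`, a contradiction.
-/

namespace CStarFrames

/-! ### Functions vanishing at infinity -/

section VanishingAtInfinity

variable {K E 𝕜 : Type*} [TopologicalSpace K] [NormedAddCommGroup E] [RCLike 𝕜]

theorem norm_apply_le_norm (f : C₀(K, E)) (t : K) : ‖f t‖ ≤ ‖f‖ :=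
  f.toBCF.norm_coe_le_norm t

theorem norm_le_of_forall_norm_apply_le {f : C₀(K, E)} {M : ℝ} (hM : 0 ≤ M)
    (h : ∀ t, ‖f t‖ ≤ M) : ‖f‖ ≤ M :=
  (BoundedContinuousFunction.norm_le (f := f.toBCF) hM).2 h

theorem sum_apply {ι : Type*} (s : Finset ι) (g : ι → C₀(K, E)) (t : K) :
    (∑ i ∈ s, g i) t = ∑ i ∈ s, g i t := by
  induction s using Finset.cons_induction with
  | empty => simp
  | cons a s ha ih => simp [ih]

theorem isCompact_setOf_le_norm_apply (f : C₀(K, E)) {r : ℝ} (hr : 0 < r) :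
    IsCompact {t | r ≤ ‖f t‖} := by
  have hlt : ∀ᶠ t in cocompact K, ‖f t‖ < r :=
    f.zero_at_infty'.norm.eventually_lt_const (by simpa using hr)
  obtain ⟨C, hC, hCr⟩ := mem_cocompact'.1 hlt
  exact hC.of_isClosed_subset (isClosed_le continuous_const f.1.continuous.norm)
    fun t (ht : r ≤ ‖f t‖) => hCr (show ¬ ‖f t‖ < r from not_lt.2 ht)

theorem isSigmaCompact_support (f : C₀(K, E)) : IsSigmaCompact (Function.support f) := by
  have hsupp : Function.support f = ⋃ n : ℕ, {t | 1 / ((n : ℝ) + 1) ≤ ‖f t‖} := by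
    ext t
    simp only [Function.mem_support, mem_iUnion, mem_ofPred_eq]
    refine ⟨fun h => ?_, fun ⟨n, hn⟩ => norm_pos_iff.1 (Nat.one_div_pos_of_nat.trans_le hn)⟩
    obtain ⟨n, hn⟩ := exists_nat_one_div_lt (norm_pos_iff.2 h)
    exact ⟨n, hn.le⟩
  rw [hsupp]
  exact isSigmaCompact_iUnion_of_isCompact _ fun n =>
    isCompact_setOf_le_norm_apply f Nat.one_div_pos_of_nat

variable (𝕜) in
theorem exists_eqOn_one_of_isCompact [R1Space K] [LocallyCompactSpace K] {C : Set K}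
    (hC : IsCompact C) : ∃ e : C₀(K, 𝕜), EqOn e 1 C ∧ ‖e‖ ≤ 1 := by
  obtain ⟨f, hf1, -, hfc, hf01⟩ :=
    exists_continuous_one_zero_of_isCompact hC isClosed_empty (disjoint_empty C)
  have hf : Tendsto f (cocompact K) (𝓝 0) := hfc.is_zero_at_infty
  refine ⟨⟨⟨fun t => (f t : 𝕜), by fun_prop⟩, ?_⟩, fun t ht => ?_,
    norm_le_of_forall_norm_apply_le zero_le_one fun t => ?_⟩
  · exact (RCLike.continuous_ofReal.tendsto' 0 0 RCLike.ofReal_zero).comp hf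
  · change ((f t : ℝ) : 𝕜) = 1
    simp [hf1 ht]
  · change ‖((f t : ℝ) : 𝕜)‖ ≤ 1
    rw [RCLike.norm_ofReal, abs_of_nonneg (hf01 t).1]
    exact (hf01 t).2

end VanishingAtInfinity

/-! ### Bounded functionals on `C₀(K)` -/

section Functionals

variable {K 𝕜 : Type*} [TopologicalSpace K] [RCLike 𝕜]

theorem norm_add_norm_le_of_disjoint_support (φ : C₀(K, 𝕜) →L[𝕜] 𝕜) {f g : C₀(K, 𝕜)}
    (hfg : Disjoint (Function.support f) (Function.support g)) :
    ‖φ f‖ + ‖φ g‖ ≤ ‖φ‖ * max ‖f‖ ‖g‖ := by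
  obtain ⟨a, ha, hfa⟩ := RCLike.exists_norm_eq_mul_self (φ f)
  obtain ⟨b, hb, hgb⟩ := RCLike.exists_norm_eq_mul_self (φ g)
  have hnorm : ‖a • f + b • g‖ ≤ max ‖f‖ ‖g‖ :=
    norm_le_of_forall_norm_apply_le (by positivity) fun t => by
      have hft := norm_apply_le_norm f t
      have hgt := norm_apply_le_norm g t
      by_cases ht : f t = 0
      · simp [ht, hb, hgt]
      · have ht' : g t = 0 := by simpa using disjoint_left.1 hfg ht
        simp [ht', ha, hft]
  have heval : φ (a • f + b • g) = ((‖φ f‖ + ‖φ g‖ : ℝ) : 𝕜) := by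
    rw [map_add, map_smul, map_smul, smul_eq_mul, smul_eq_mul, ← hfa, ← hgb, RCLike.ofReal_add]
  calc ‖φ f‖ + ‖φ g‖ = ‖φ (a • f + b • g)‖ := by
        rw [heval, RCLike.norm_ofReal, abs_of_nonneg (by positivity)]
    _ ≤ ‖φ‖ * max ‖f‖ ‖g‖ := φ.le_of_opNorm_le_of_le le_rfl hnorm

theorem exists_isSigmaCompact_forall_eqOn_zero (φ : C₀(K, 𝕜) →L[𝕜] 𝕜) :
    ∃ S : Set K, IsSigmaCompact S ∧ ∀ g : C₀(K, 𝕜), EqOn g 0 S → φ g = 0 := by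
  -- `S` carries functions almost attaining the norm of `φ`, so nothing is left for the rest of `K`.
  have hattain (n : ℕ) : ∃ f : C₀(K, 𝕜), ‖f‖ < 1 ∧ ‖φ‖ - 1 / ((n : ℝ) + 1) < ‖φ f‖ :=
    φ.exists_lt_apply_of_lt_opNorm (sub_lt_self _ Nat.one_div_pos_of_nat)
  choose f hf hφf using hattain
  refine ⟨⋃ n, Function.support (f n),
    isSigmaCompact_iUnion _ fun n => isSigmaCompact_support _, fun g hg => ?_⟩
  have hdisj (n : ℕ) (c : 𝕜) : Disjoint (Function.support (f n)) (Function.support (c • g)) :=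
    disjoint_left.2 fun t ht hgt => hgt <| by simp [hg (mem_iUnion_of_mem n ht)]
  set u : C₀(K, 𝕜) := ((‖g‖⁻¹ : ℝ) : 𝕜) • g with hu
  have hu1 : ‖u‖ ≤ 1 := by
    rw [hu, norm_smul, RCLike.norm_ofReal, abs_of_nonneg (by positivity)]
    exact inv_mul_le_one
  have hle (n : ℕ) : ‖φ u‖ ≤ 1 / ((n : ℝ) + 1) := by
    have hsum := (norm_add_norm_le_of_disjoint_support φ (hdisj n _)).trans
      (mul_le_of_le_one_right (norm_nonneg φ) (max_le (hf n).le hu1))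
    linarith [hφf n]
  have hφu : φ u = 0 :=
    norm_le_zero_iff.1 (ge_of_tendsto' tendsto_one_div_add_atTop_nhds_zero_nat hle)
  rcases eq_or_ne g 0 with rfl | hg0
  · exact map_zero φ
  · rw [hu, map_smul, smul_eq_zero] at hφu
    exact hφu.resolve_left (by simpa using hg0)

theorem sum_norm_sq_apply_le (φ : C₀(K, 𝕜) →L[𝕜] 𝕜) {ι : Type*} (s : Finset ι)
    (g : ι → C₀(K, 𝕜)) {M : ℝ} (hM : 0 ≤ M) (hg : ∀ t, ∑ i ∈ s, ‖g i t‖ ^ 2 ≤ M) :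
    ∑ i ∈ s, ‖φ (g i)‖ ^ 2 ≤ ‖φ‖ ^ 2 * M := by
  set Q : ℝ := ∑ i ∈ s, ‖φ (g i)‖ ^ 2 with hQ
  have hQ0 : 0 ≤ Q := Finset.sum_nonneg fun i _ => by positivity
  -- Testing `φ` on `h = ∑ᵢ conj (φ gᵢ) gᵢ` gives `Q = φ h`, while `‖h‖² ≤ Q M` by Cauchy-Schwarz.
  set h : C₀(K, 𝕜) := ∑ i ∈ s, star (φ (g i)) • g i with hh
  have hφh : φ h = (Q : 𝕜) := by
    rw [hh, map_sum, hQ, RCLike.ofReal_sum]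
    refine Finset.sum_congr rfl fun i _ => ?_
    rw [map_smul, smul_eq_mul, RCLike.star_def, RCLike.conj_mul, RCLike.ofReal_pow]
  have hnorm : ‖h‖ ≤ √(Q * M) := norm_le_of_forall_norm_apply_le (by positivity) fun t => by
    refine Real.le_sqrt_of_sq_le ?_
    calc ‖h t‖ ^ 2 ≤ (∑ i ∈ s, ‖φ (g i)‖ * ‖g i t‖) ^ 2 := by
          gcongr
          rw [hh, sum_apply]
          exact norm_sum_le_of_le _ fun i _ => by simp
      _ ≤ Q * ∑ i ∈ s, ‖g i t‖ ^ 2 := Finset.sum_mul_sq_le_sq_mul_sq _ _ _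
      _ ≤ Q * M := by gcongr; exact hg t
  have hQQ : Q * Q ≤ Q * (‖φ‖ ^ 2 * M) :=
    calc Q * Q = ‖φ h‖ ^ 2 := by rw [hφh, RCLike.norm_ofReal, sq_abs, sq]
      _ ≤ (‖φ‖ * √(Q * M)) ^ 2 := by gcongr; exact φ.le_of_opNorm_le_of_le le_rfl hnorm
      _ = Q * (‖φ‖ ^ 2 * M) := by rw [mul_pow, Real.sq_sqrt (by positivity)]; ring
  rcases hQ0.eq_or_lt with hQ0 | hQ0
  · rw [← hQ0]; positivity
  · exact le_of_mul_le_mul_left hQQ hQ0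

end Functionals

/-! ### The classes of spaces -/

section Classes

variable {K P P₁ P₂ : Type*} [TopologicalSpace K] [TopologicalSpace P] [TopologicalSpace P₁]
  [TopologicalSpace P₂]

theorem isSigmaCompact_preimage_of_isClosedEmbedding {i : P → K} (hi : IsClosedEmbedding i)
    {s : Set K} (hs : IsSigmaCompact s) : IsSigmaCompact (i ⁻¹' s) := by
  obtain ⟨C, hC, rfl⟩ := hs
  rw [preimage_iUnion]
  exact isSigmaCompact_iUnion_of_isCompact _ fun n => hi.isCompact_preimage (hC n)

theorem isCompact_closure_image_iff_of_isClosedEmbedding {i : P → K} (hi : IsClosedEmbedding i)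
    {s : Set P} : IsCompact (closure (i '' s)) ↔ IsCompact (closure s) := by
  rw [hi.closure_image_eq, hi.isEmbedding.isCompact_iff]

theorem locallyCompactSpace_sum [LocallyCompactSpace P₁] [LocallyCompactSpace P₂] :
    LocallyCompactSpace (P₁ ⊕ P₂) := by
  refine ⟨?_⟩
  rintro (x | y) n hn
  · obtain ⟨s, hs, hsn, hsc⟩ :=
      local_compact_nhds (continuous_inl.continuousAt.preimage_mem_nhds hn)
    exact ⟨Sum.inl '' s, IsOpenEmbedding.inl.isOpenMap.image_mem_nhds hs,
      image_subset_iff.2 hsn, hsc.image continuous_inl⟩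
  · obtain ⟨s, hs, hsn, hsc⟩ :=
      local_compact_nhds (continuous_inr.continuousAt.preimage_mem_nhds hn)
    exact ⟨Sum.inr '' s, IsOpenEmbedding.inr.isOpenMap.image_mem_nhds hs,
      image_subset_iff.2 hsn, hsc.image continuous_inr⟩

theorem ClassIV.not_sigmaCompactSpace (hP : ClassIV P) : ¬ SigmaCompactSpace P := fun h => by
  simpa using hP.2.2.1 _ h.isSigmaCompact_univ

theorem ClassIV.noncompactSpace (hP : ClassIV P) : NoncompactSpace P :=
  not_compactSpace_iff.1 fun _ => hP.not_sigmaCompactSpace inferInstance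

theorem ClassIV.exists_mapClusterPt (hP : ClassIV P) (p : ℕ → P) :
    ∃ q, MapClusterPt q atTop p := by
  have hcompact : IsCompact (closure (range p)) := hP.2.2.2 _ <| by
    rw [← iUnion_singleton_eq_range]
    exact isSigmaCompact_iUnion_of_isCompact _ fun _ => isCompact_singleton
  obtain ⟨q, -, hq⟩ := hcompact.exists_mapClusterPt (f := atTop) (u := p) <|
    tendsto_principal.2 <| .of_forall fun n => subset_closure (mem_range_self n)
  exact ⟨q, hq⟩

theorem not_classIV_of_classI_or_classII_or_classIII (h : ClassI P ∨ ClassII P ∨ ClassIII P) :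
    ¬ ClassIV P := by
  intro hP
  rcases h with h | ⟨-, -, -, s, hs, hdense⟩ | ⟨-, -, -, s, hs, hclosure⟩
  · exact hP.not_sigmaCompactSpace h.2.2
  · simpa [hdense.interior_compl] using hP.2.2.1 s hs
  · exact hclosure (hP.2.2.2 s hs)

theorem exists_isSigmaCompact_not_isCompact_closure [LocallyCompactSpace P] [T2Space P]
    (hIV : ¬ ClassIV P) (hc : ¬ CompactSpace P) :
    ∃ s : Set P, IsSigmaCompact s ∧ ¬ IsCompact (closure s) := by
  by_contra! hprecompact
  refine hIV ⟨‹_›, ‹_›, fun s hs => ?_, hprecompact⟩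
  by_contra! hint
  have hdense : Dense s := by rwa [interior_eq_empty_iff_dense_compl, compl_compl] at hint
  exact hc ⟨hdense.closure_eq ▸ hprecompact s hs⟩

theorem ClassIV.classIII_sum [LocallyCompactSpace P₂] [T2Space P₂] (h₁ : ClassIV P₁)
    (h₂ : ∃ s : Set P₂, IsSigmaCompact s ∧ ¬ IsCompact (closure s)) : ClassIII (P₁ ⊕ P₂) := by
  have : LocallyCompactSpace P₁ := h₁.1
  have : T2Space P₁ := h₁.2.1
  refine ⟨locallyCompactSpace_sum, inferInstance, fun s hs => ?_, ?_⟩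
  · have hint : (interior (Sum.inl ⁻¹' sᶜ)).Nonempty :=
      h₁.2.2.1 _ (isSigmaCompact_preimage_of_isClosedEmbedding .inl hs)
    rw [← IsOpenEmbedding.inl.isOpenMap.preimage_interior_eq_interior_preimage continuous_inl]
      at hint
    obtain ⟨t, ht⟩ := hint
    exact ⟨Sum.inl t, ht⟩
  · obtain ⟨s, hs, hclosure⟩ := h₂
    exact ⟨Sum.inr '' s, hs.image continuous_inr,
      mt (isCompact_closure_image_iff_of_isClosedEmbedding .inr).1 hclosure⟩

theorem iUnion_ne_univ_of_forall_countable (hσ : ¬ SigmaCompactSpace P)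
    (hcluster : ∀ p : ℕ → P, ∃ q, MapClusterPt q atTop p) {J : Type*} {U : J → Set P}
    (hUo : ∀ j, IsOpen (U j)) (hUσ : ∀ j, IsSigmaCompact (U j))
    (hcount : ∀ p, {j | p ∈ U j}.Countable) : ⋃ j, U j ≠ univ := by
  intro hcover
  have hescape (s : Finset P) : ∃ q, ∀ p ∈ s, ∀ j, p ∈ U j → q ∉ U j := by
    by_contra! hmeet
    refine hσ (isSigmaCompact_univ_iff.1 ?_)
    have huniv : ⋃ p ∈ (s : Set P), ⋃ j ∈ {j | p ∈ U j}, U j = univ :=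
      eq_univ_of_forall fun q => by
        obtain ⟨p, hp, j, hpj, hqj⟩ := hmeet q
        exact mem_biUnion (Finset.mem_coe.2 hp) (mem_biUnion (show j ∈ {j | p ∈ U j} from hpj) hqj)
    exact huniv ▸ isSigmaCompact_biUnion s.countable_toSet fun p _ =>
      isSigmaCompact_biUnion (hcount p) fun j _ => hUσ j
  obtain ⟨p, -, hp⟩ := exists_seq_of_forall_finset_exists (fun _ : P => True)
    (fun p q => ∀ j, p ∈ U j → q ∉ U j) fun s _ => (hescape s).imp fun _ => .intro trivial
  obtain ⟨q, hq⟩ := hcluster p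
  obtain ⟨j, hj⟩ := mem_iUnion.1 (hcover ▸ mem_univ q)
  have hfreq : ∃ᶠ n in atTop, p n ∈ U j := hq.frequently ((hUo j).mem_nhds hj)
  obtain ⟨m, -, hm⟩ := frequently_atTop.1 hfreq 0
  obtain ⟨n, hmn, hn⟩ := frequently_atTop.1 hfreq (m + 1)
  exact hp m n hmn j hm hn

end Classes

/-! ### Multiplication operators -/

section MultiplicationOperators

variable {K : Type*} [TopologicalSpace K]

theorem isModuleOperator_mulOperator (b : K →ᵇ ℂ) : IsModuleOperator (mulOperator b) :=
  fun x a => by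
    ext t
    simp [mulOperator_apply, mul_assoc]

theorem isAdjointable_mulOperator (b : K →ᵇ ℂ) : IsAdjointable (mulOperator b) := by
  refine ⟨isModuleOperator_mulOperator b, mulOperator (star b), isModuleOperator_mulOperator _,
    fun x y => ?_⟩
  ext t
  simp only [ZeroAtInftyContinuousMap.mul_apply, ZeroAtInftyContinuousMap.star_apply,
    mulOperator_apply, BoundedContinuousFunction.star_apply, star_mul']
  ring

theorem exists_eq_mul_of_mem_span_theta {A : Type*} [NonUnitalCStarAlgebra A] {T : A →L[ℂ] A}
    (hT : T ∈ Submodule.span ℂ {T : A →L[ℂ] A | ∃ x y : A, T = theta x y}) :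
    ∃ g : A, ∀ z, T z = g * z := by
  induction hT using Submodule.span_induction with
  | mem T hT =>
    obtain ⟨x, y, rfl⟩ := hT
    exact ⟨x * star y, fun z => by rw [theta_apply, mul_assoc]⟩
  | zero => exact ⟨0, fun z => by simp⟩
  | add S T _ _ hS hT =>
    obtain ⟨g, hg⟩ := hS
    obtain ⟨h, hh⟩ := hT
    exact ⟨g + h, fun z => by simp [hg, hh, add_mul]⟩
  | smul c T _ hT =>
    obtain ⟨g, hg⟩ := hT
    exact ⟨c • g, fun z => by simp [hg, smul_mul_assoc]⟩

theorem norm_le_opNorm_of_forall_apply_eq_mul {𝕜 : Type*} [RCLike 𝕜] [R1Space K]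
    [LocallyCompactSpace K] {T : C₀(K, 𝕜) →L[𝕜] C₀(K, 𝕜)} {c : K → 𝕜}
    (hT : ∀ z t, T z t = c t * z t) (t : K) : ‖c t‖ ≤ ‖T‖ := by
  obtain ⟨e, het, he⟩ := exists_eqOn_one_of_isCompact 𝕜 (isCompact_singleton (x := t))
  calc ‖c t‖ = ‖T e t‖ := by simp [hT, het (mem_singleton t)]
    _ ≤ ‖T e‖ := norm_apply_le_norm _ t
    _ ≤ ‖T‖ := by simpa using T.le_of_opNorm_le_of_le le_rfl he

theorem tendsto_cocompact_zero_of_isACompact_mulOperator [R1Space K] [LocallyCompactSpace K]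
    {b : K →ᵇ ℂ} (hb : IsACompact (mulOperator b)) : Tendsto b (cocompact K) (𝓝 0) := by
  rw [tendsto_zero_iff_norm_tendsto_zero, tendsto_order]
  refine ⟨fun r hr => .of_forall fun t => hr.trans_le (norm_nonneg _), fun ε hε => ?_⟩
  obtain ⟨T, hT, hbT⟩ := Metric.mem_closure_iff.1 hb (ε / 2) (half_pos hε)
  obtain ⟨g, hg⟩ := exists_eq_mul_of_mem_span_theta hT
  have hbg (t : K) : ‖b t - g t‖ < ε / 2 := by
    rw [dist_eq_norm] at hbT
    refine (norm_le_opNorm_of_forall_apply_eq_mul (c := fun t => b t - g t) (fun z t => ?_)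
      t).trans_lt hbT
    simp [mulOperator_apply, hg, sub_mul]
  have hg0 : ∀ᶠ t in cocompact K, ‖g t‖ < ε / 2 :=
    g.zero_at_infty'.norm.eventually_lt_const (by simpa using hε)
  filter_upwards [hg0] with t ht
  linarith [hbg t, norm_le_norm_add_norm_sub' (b t) (g t)]

end MultiplicationOperators

/-! ### Total boundedness -/

section TotalBoundedness

variable {K : Type*} [TopologicalSpace K] {X : ℕ → K →ᵇ ℂ} {Φ : ℕ → C₀(K, ℂ) →L[ℂ] ℂ}

theorem exists_finite_subset_forall_norm_apply_sub_lt {𝕜 𝕜' E F ι : Type*}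
    [NontriviallyNormedField 𝕜] [NontriviallyNormedField 𝕜'] {σ : 𝕜 →+* 𝕜'} [RingHomIsometric σ]
    [SeminormedAddCommGroup E] [NormedSpace 𝕜 E] [SeminormedAddCommGroup F] [NormedSpace 𝕜' F]
    [ProperSpace F] [Finite ι] (L : ι → E →SL[σ] F) {Y : Set E} (hY : Bornology.IsBounded Y)
    {ε : ℝ} (hε : 0 < ε) :
    ∃ N ⊆ Y, N.Finite ∧ ∀ y ∈ Y, ∃ z ∈ N, ∀ p, ‖L p (z - y)‖ < ε := by
  have := Fintype.ofFinite ι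
  let Ψ : E → ι → F := fun x p => L p x
  have hbdd : Bornology.IsBounded (Ψ '' Y) :=
    Bornology.forall_isBounded_image_eval_iff.1 fun p => by
      rw [image_image]
      exact (L p).lipschitz.isBounded_image hY
  have htb : TotallyBounded (Ψ '' Y) := hbdd.isCompact_closure.totallyBounded.subset subset_closure
  obtain ⟨t, htY, ht, hcover⟩ := Metric.finite_approx_of_totallyBounded htb ε hε
  obtain ⟨N, hNY, hN, rfl⟩ := exists_subset_image_finite_and (p := (· = t)).1 ⟨t, htY, ht, rfl⟩
  refine ⟨N, hNY, hN, fun y hy => ?_⟩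
  obtain ⟨_, ⟨z, hz, rfl⟩, hzy⟩ := mem_iUnion₂.1 (hcover (mem_image_of_mem Ψ hy))
  refine ⟨z, hz, fun p => ?_⟩
  rw [map_sub, ← dist_eq_norm, dist_comm]
  exact (dist_le_pi_dist (Ψ y) (Ψ z) p).trans_lt hzy

/-- The conjugate linear operator `x ↦ ⟨x, b⟩` on `C₀(K)`, for `b ∈ C_b(K)`. -/
noncomputable def innerMultiplierCLM (b : K →ᵇ ℂ) : C₀(K, ℂ) →L⋆[ℂ] C₀(K, ℂ) :=
  (mulOperator b).comp (starL ℂ : C₀(K, ℂ) ≃L⋆[ℂ] C₀(K, ℂ)).toContinuousLinearMap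

theorem innerMultiplier_sub (x y : C₀(K, ℂ)) (b : K →ᵇ ℂ) :
    innerMultiplier (x - y) b = innerMultiplier x b - innerMultiplier y b :=
  map_sub (innerMultiplierCLM b) x y

theorem nu_le_ofReal {x : C₀(K, ℂ)} {r : ℝ} (hr : 0 ≤ r)
    (h : ∀ (k : ℕ) (s : Finset ℕ), (∀ i ∈ s, k ≤ i) →
      ∑ i ∈ s, ‖Φ k (innerMultiplier x (X i))‖ ^ 2 ≤ r ^ 2) :
    nu X Φ x ≤ ENNReal.ofReal r := by
  have hsum (k : ℕ) : ∑' i : ℕ, ‖Φ k (innerMultiplier x (X (k + i)))‖ₑ ^ 2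
      ≤ ENNReal.ofReal (r ^ 2) := by
    rw [ENNReal.tsum_eq_iSup_sum]
    refine iSup_le fun s => ?_
    calc ∑ i ∈ s, ‖Φ k (innerMultiplier x (X (k + i)))‖ₑ ^ 2
        = ENNReal.ofReal (∑ i ∈ s.map (addLeftEmbedding k),
            ‖Φ k (innerMultiplier x (X i))‖ ^ 2) := by
          rw [Finset.sum_map, ENNReal.ofReal_sum_of_nonneg fun _ _ => by positivity]
          simp only [addLeftEmbedding_apply, ENNReal.ofReal_pow (norm_nonneg _), ofReal_norm]
      _ ≤ ENNReal.ofReal (r ^ 2) := ENNReal.ofReal_le_ofReal (h k _ (by simp))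
  calc nu X Φ x ≤ ENNReal.ofReal (r ^ 2) ^ (1 / 2 : ℝ) :=
        ENNReal.rpow_le_rpow (iSup_le hsum) (by norm_num)
    _ = ENNReal.ofReal r := by
        rw [ENNReal.ofReal_rpow_of_nonneg (by positivity) (by norm_num), ← Real.sqrt_eq_rpow,
          Real.sqrt_sq hr]

theorem sum_innerMultiplier_mul_star_apply (s : Finset ℕ) (x : C₀(K, ℂ)) (t : K) :
    (∑ i ∈ s, innerMultiplier x (X i) * star (innerMultiplier x (X i))) t =
      ((∑ i ∈ s, ‖innerMultiplier x (X i) t‖ ^ 2 : ℝ) : ℂ) := by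
  rw [sum_apply, Complex.ofReal_sum]
  refine Finset.sum_congr rfl fun i _ => ?_
  rw [Complex.ofReal_pow]
  exact Complex.mul_conj' _

theorem IsAdmissible.exists_forall_sum_norm_sq_innerMultiplier_le (hX : IsAdmissible X)
    (e : C₀(K, ℂ)) {δ : ℝ} (hδ : 0 < δ) :
    ∃ m, ∀ s : Finset ℕ, (∀ i ∈ s, m ≤ i) →
      ∀ t, ∑ i ∈ s, ‖innerMultiplier e (X i) t‖ ^ 2 ≤ δ := by
  obtain ⟨S, hS, -⟩ := hX.1 e
  obtain ⟨m, hm⟩ := Metric.cauchySeq_iff'.1 hS.cauchySeq δ hδ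
  refine ⟨m, fun s hs t => ?_⟩
  obtain ⟨n, hn⟩ := s.exists_nat_subset_range
  have hsub : s ⊆ Finset.Ico m (max m n) := fun i hi =>
    Finset.mem_Ico.2 ⟨hs i hi, lt_max_of_lt_right (Finset.mem_range.1 (hn hi))⟩
  have hle := (hm (max m n) (le_max_left _ _)).le
  rw [dist_eq_norm, ← Finset.sum_Ico_eq_sub _ (le_max_left m n)] at hle
  calc ∑ i ∈ s, ‖innerMultiplier e (X i) t‖ ^ 2
      ≤ ∑ i ∈ Finset.Ico m (max m n), ‖innerMultiplier e (X i) t‖ ^ 2 :=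
        Finset.sum_le_sum_of_subset_of_nonneg hsub fun _ _ _ => by positivity
    _ = ‖(∑ i ∈ Finset.Ico m (max m n),
          innerMultiplier e (X i) * star (innerMultiplier e (X i))) t‖ := by
        rw [sum_innerMultiplier_mul_star_apply, Complex.norm_real, Real.norm_of_nonneg]
        exact Finset.sum_nonneg fun _ _ => by positivity
    _ ≤ δ := (norm_apply_le_norm _ t).trans hle

theorem IsAdmissible.exists_forall_sum_norm_sq_apply_mul_le (hX : IsAdmissible X) (e : C₀(K, ℂ))
    (R : ℝ) {δ : ℝ} (hδ : 0 < δ) :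
    ∃ m, ∀ (φ : C₀(K, ℂ) →L[ℂ] ℂ) (x : C₀(K, ℂ)) (s : Finset ℕ), ‖φ‖ ≤ 1 → ‖x‖ ≤ R →
      (∀ i ∈ s, m ≤ i) → ∑ i ∈ s, ‖φ (innerMultiplier (e * x) (X i))‖ ^ 2 ≤ δ := by
  obtain ⟨m, hm⟩ := hX.exists_forall_sum_norm_sq_innerMultiplier_le e
    (δ := δ / (R ^ 2 + 1)) (by positivity)
  refine ⟨m, fun φ x s hφ hx hs => ?_⟩
  have hpointwise (t : K) : ∑ i ∈ s, ‖innerMultiplier (e * x) (X i) t‖ ^ 2 ≤ δ :=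
    calc ∑ i ∈ s, ‖innerMultiplier (e * x) (X i) t‖ ^ 2
        = ‖x t‖ ^ 2 * ∑ i ∈ s, ‖innerMultiplier e (X i) t‖ ^ 2 := by
          rw [Finset.mul_sum]
          refine Finset.sum_congr rfl fun i _ => ?_
          simp only [innerMultiplier_apply, ZeroAtInftyContinuousMap.mul_apply, norm_mul, norm_star]
          ring
      _ ≤ (R ^ 2 + 1) * (δ / (R ^ 2 + 1)) := by
          gcongr
          · exact (pow_le_pow_left₀ (norm_nonneg _) ((norm_apply_le_norm x t).trans hx) 2).trans
              (le_add_of_nonneg_right zero_le_one)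
          · exact hm s hs t
      _ = δ := mul_div_cancel₀ _ (by positivity)
  calc ∑ i ∈ s, ‖φ (innerMultiplier (e * x) (X i))‖ ^ 2
      ≤ ‖φ‖ ^ 2 * δ := sum_norm_sq_apply_le φ s _ hδ.le hpointwise
    _ ≤ δ := mul_le_of_le_one_left hδ.le (pow_le_one₀ φ.opNorm_nonneg hφ)

theorem exists_finite_subset_forall_sum_range_le {Y : Set C₀(K, ℂ)} (hY : Bornology.IsBounded Y)
    (X : ℕ → K →ᵇ ℂ) (Φ : ℕ → C₀(K, ℂ) →L[ℂ] ℂ) (m : ℕ) {δ : ℝ} (hδ : 0 < δ) :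
    ∃ N ⊆ Y, N.Finite ∧ ∀ y ∈ Y, ∃ z ∈ N, ∀ k < m,
      ∑ i ∈ Finset.range m, ‖Φ k (innerMultiplier (z - y) (X i))‖ ^ 2 ≤ δ := by
  obtain ⟨N, hNY, hN, hnet⟩ := exists_finite_subset_forall_norm_apply_sub_lt
    (fun p : Fin m × Fin m => (Φ p.1).comp (innerMultiplierCLM (X p.2))) hY
    (ε := √(δ / (m + 1))) (by positivity)
  refine ⟨N, hNY, hN, fun y hy => ?_⟩
  obtain ⟨z, hz, hzy⟩ := hnet y hy
  refine ⟨z, hz, fun k hk => ?_⟩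
  have hterm : ∀ i ∈ Finset.range m,
      ‖Φ k (innerMultiplier (z - y) (X i))‖ ^ 2 ≤ δ / (m + 1) := fun i hi =>
    (Real.lt_sqrt (norm_nonneg _)).1 (hzy (⟨k, hk⟩, ⟨i, Finset.mem_range.1 hi⟩)) |>.le
  calc ∑ i ∈ Finset.range m, ‖Φ k (innerMultiplier (z - y) (X i))‖ ^ 2
      ≤ m * (δ / (m + 1)) := by simpa using Finset.sum_le_card_nsmul _ _ _ hterm
    _ ≤ (m + 1) * (δ / (m + 1)) := by gcongr; linarith
    _ = δ := mul_div_cancel₀ _ (by positivity)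

theorem exists_forall_apply_innerMultiplier_eq_apply_mul {Y : Set C₀(K, ℂ)}
    (hY : ∀ S, IsSigmaCompact S → ∃ e : C₀(K, ℂ), ∀ y ∈ Y, EqOn y (e * y) S)
    (Φ : ℕ → C₀(K, ℂ) →L[ℂ] ℂ) :
    ∃ e : C₀(K, ℂ), ∀ y ∈ Y, ∀ k b,
      Φ k (innerMultiplier y b) = Φ k (innerMultiplier (e * y) b) := by
  choose S hS hSΦ using fun k => exists_isSigmaCompact_forall_eqOn_zero (Φ k)
  obtain ⟨e, he⟩ := hY _ (isSigmaCompact_iUnion S hS)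
  refine ⟨e, fun y hy k b => ?_⟩
  rw [← sub_eq_zero, ← map_sub, ← innerMultiplier_sub]
  refine hSΦ k _ fun t ht => ?_
  have het : y t = e t * y t := he y hy (mem_iUnion_of_mem k ht)
  change b t * star (y t - e t * y t) = 0
  rw [← het, sub_self, star_zero, mul_zero]

theorem isOuterTotallyBounded_of_forall_exists_eqOn_mul {Y : Set C₀(K, ℂ)}
    (hYb : Bornology.IsBounded Y)
    (hYe : ∀ S, IsSigmaCompact S → ∃ e : C₀(K, ℂ), ∀ y ∈ Y, EqOn y (e * y) S) :
    IsOuterTotallyBounded Y := by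
  intro X Φ hX hΦ ε hε
  obtain ⟨R, hR⟩ := hYb.exists_norm_le
  obtain ⟨e, he⟩ := exists_forall_apply_innerMultiplier_eq_apply_mul hYe Φ
  have hδ : 0 < ε ^ 2 / 8 := by positivity
  obtain ⟨m, hm⟩ := hX.exists_forall_sum_norm_sq_apply_mul_le e (R + R) hδ
  obtain ⟨N, hNY, hN, hnet⟩ := exists_finite_subset_forall_sum_range_le hYb X Φ m hδ
  refine ⟨N, hN, hNY, fun y hy => ?_⟩
  obtain ⟨z, hz, hzy⟩ := hnet y hy
  refine ⟨z, hz, (nu_le_ofReal (half_pos hε).le fun k s hs => ?_).trans_lt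
    ((ENNReal.ofReal_lt_ofReal_iff hε).2 (half_lt_self hε))⟩
  have hhead : ∑ i ∈ s with i < m, ‖Φ k (innerMultiplier (z - y) (X i))‖ ^ 2 ≤ ε ^ 2 / 8 := by
    rcases lt_or_ge k m with hk | hk
    · refine (Finset.sum_le_sum_of_subset_of_nonneg (fun i hi => ?_)
        fun _ _ _ => by positivity).trans (hzy k hk)
      exact Finset.mem_range.2 (Finset.mem_filter.1 hi).2
    · rw [Finset.filter_false_of_mem fun i hi => not_lt.2 (hk.trans (hs i hi)), Finset.sum_empty]
      exact hδ.le
  have htail : ∑ i ∈ s with ¬ i < m, ‖Φ k (innerMultiplier (z - y) (X i))‖ ^ 2 ≤ ε ^ 2 / 8 := by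
    have hunit (i : ℕ) : Φ k (innerMultiplier (z - y) (X i)) =
        Φ k (innerMultiplier (e * (z - y)) (X i)) := by
      rw [mul_sub, innerMultiplier_sub, innerMultiplier_sub, map_sub, map_sub, he z (hNY hz),
        he y hy]
    simp only [hunit]
    exact hm (Φ k) (z - y) _ (hΦ k).2.le (norm_sub_le_of_le (hR z (hNY hz)) (hR y hy))
      fun i hi => not_lt.1 (Finset.mem_filter.1 hi).2
  rw [← Finset.sum_filter_add_sum_filter_not s (· < m)]
  linarith

theorem isOuterTotallyBounded_image_mulOperator [R1Space K] [LocallyCompactSpace K] {b : K →ᵇ ℂ}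
    (hb : ∀ S, IsSigmaCompact S → IsCompact (closure (S ∩ Function.support b)))
    {Y : Set C₀(K, ℂ)} (hY : Bornology.IsBounded Y) :
    IsOuterTotallyBounded (mulOperator b '' Y) := by
  refine isOuterTotallyBounded_of_forall_exists_eqOn_mul
    ((mulOperator b).lipschitz.isBounded_image hY) fun S hS => ?_
  obtain ⟨e, he, -⟩ := exists_eqOn_one_of_isCompact ℂ (hb S hS)
  refine ⟨e, ?_⟩
  rintro _ ⟨y, -, rfl⟩ t ht
  by_cases hbt : b t = 0
  · simp [mulOperator_apply, hbt]
  · simp [he (subset_closure ⟨ht, hbt⟩)]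

end TotalBoundedness

/-! ### Frames -/

section ScalarFrameBounds

theorem UltraweakTendsto.tendsto_inner_self {H : Type*} [NormedAddCommGroup H]
    [InnerProductSpace ℂ H] {ι : Type*} {S : ι → H →L[ℂ] H} {l : Filter ι} {T : H →L[ℂ] H}
    (h : UltraweakTendsto S l T) (ξ : H) :
    Tendsto (fun i => ⟪ξ, S i ξ⟫_ℂ) l (𝓝 ⟪ξ, T ξ⟫_ℂ) := by
  let ξ₀ : ℕ → H := Pi.single 0 ξ
  have hξ₀ : ∀ n ≠ 0, ξ₀ n = 0 := fun n hn => by simp [ξ₀, hn]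
  have hsummable : Summable fun n => ‖ξ₀ n‖ ^ 2 :=
    summable_of_ne_finset_zero (s := {0}) fun n hn => by simp [hξ₀ n (by simpa using hn)]
  have hsum (R : H →L[ℂ] H) : ∑' n, ⟪ξ₀ n, R (ξ₀ n)⟫_ℂ = ⟪ξ, R ξ⟫_ℂ := by
    rw [tsum_eq_single 0 fun n hn => by simp [hξ₀ n hn]]
    simp [ξ₀]
  simpa only [hsum] using h ξ₀ ξ₀ hsummable hsummable

theorem mul_inner_le_inner_of_smul_le {H : Type*} [NormedAddCommGroup H] [InnerProductSpace ℂ H]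
    {S T : H →L[ℂ] H} {c : ℂ} (h : c • S ≤ T) (ξ : H) : c * ⟪ξ, S ξ⟫_ℂ ≤ ⟪ξ, T ξ⟫_ℂ := by
  have hpos := ((ContinuousLinearMap.le_def _ _).1 h).inner_nonneg_right ξ
  rwa [sub_apply, inner_sub_right, sub_nonneg, smul_apply, inner_smul_right] at hpos

open Classical in
/-- The vector of the universal representation which implements the state `f`: the cyclic vector
of the GNS representation of `f`. -/
noncomputable def universalVector {B : Type*} [CStarAlgebra B] [PartialOrder B] [StarOrderedRing B]
    (f : UnitalState B) : UniversalSpace B :=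
  lp.single 2 f ((f.1.toPreGNS 1 : f.1.PreGNS) : f.1.GNS)

theorem inner_universalVector {B : Type*} [CStarAlgebra B] [PartialOrder B] [StarOrderedRing B]
    (f : UnitalState B) (b : B) :
    ⟪universalVector f, universalRep b (universalVector f)⟫_ℂ = f.1 b := by
  classical
  rw [universalVector, lp.inner_single_left, universalRep_apply, lp.single_apply_self]
  change ⟪_, f.1.gnsNonUnitalStarAlgHom b _⟫_ℂ = _
  rw [PositiveLinearMap.gnsNonUnitalStarAlgHom_apply_coe, UniformSpace.Completion.inner_coe,
    PositiveLinearMap.preGNS_inner_def]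
  simp

variable {A J : Type*} [NonUnitalCStarAlgebra A] {u : J → A}

/-- The lower frame inequality with constant `c`, tested on states of the unitization. Standard and
non-standard frames both satisfy it, and it is all that the nonexistence of frames depends on. -/
def IsScalarLowerFrameBound (u : J → A) (c : ℝ) : Prop :=
  ∀ (f : UnitalState A⁺¹) (x : A), ∃ s : ℂ,
    HasSum (fun j => f.1 (frameTerm x (u j))) s ∧ c * f.1 (innerSelf x) ≤ s

theorem IsStandardFrame.exists_isScalarLowerFrameBound (hu : IsStandardFrame u) :
    ∃ c > 0, IsScalarLowerFrameBound u c := by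
  obtain ⟨c, _, hc, -, h⟩ := hu
  refine ⟨c, hc, fun f x => ?_⟩
  obtain ⟨s, hs, hle, -⟩ := h x
  exact ⟨f.1 s, hs.map f.1 (map_continuous f.1), by simpa using OrderHomClass.mono f.1 hle⟩

theorem IsNonstandardFrame.exists_isScalarLowerFrameBound (hu : IsNonstandardFrame u) :
    ∃ c > 0, IsScalarLowerFrameBound u c := by
  obtain ⟨c, _, hc, -, h⟩ := hu
  refine ⟨c, hc, fun f x => ?_⟩
  obtain ⟨T, -, hT, hle, -⟩ := h x
  refine ⟨⟪universalVector f, T (universalVector f)⟫_ℂ, ?_, ?_⟩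
  · simpa only [HasSum, SummationFilter.unconditional_filter, ← map_sum, inner_universalVector]
      using hT.tendsto_inner_self (universalVector f)
  · simpa only [inner_universalVector] using
      mul_inner_le_inner_of_smul_le hle (universalVector f)

theorem IsFrame.exists_isScalarLowerFrameBound (hu : IsFrame u) :
    ∃ c > 0, IsScalarLowerFrameBound u c :=
  hu.elim (·.exists_isScalarLowerFrameBound) (·.exists_isScalarLowerFrameBound)

end ScalarFrameBounds

section NoFrames

variable {K : Type*} [TopologicalSpace K]

/-- Evaluation at `t`, as a character of `C₀(K)`. -/
noncomputable def evalStarHom (t : K) : C₀(K, ℂ) →⋆ₙₐ[ℂ] ℂ where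
  toFun f := f t
  map_smul' _ _ := rfl
  map_zero' := rfl
  map_add' _ _ := rfl
  map_mul' _ _ := rfl
  map_star' _ := rfl

/-- Evaluation at `t`, as a state of the unitization of `C₀(K)`. -/
noncomputable def evalState (t : K) : UnitalState C₀(K, ℂ)⁺¹ :=
  ⟨PositiveLinearMap.mk (Unitization.starLift (evalStarHom t)).toAlgHom.toLinearMap
    (OrderHomClass.mono (Unitization.starLift (evalStarHom t))),
    map_one (Unitization.starLift (evalStarHom t))⟩

theorem evalState_coe (t : K) (f : C₀(K, ℂ)) : (evalState t).1 (f : C₀(K, ℂ)⁺¹) = f t :=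
  DFunLike.congr_fun (Unitization.starLift.symm_apply_apply (evalStarHom t)) f

theorem evalState_frameTerm (t : K) (x y : C₀(K, ℂ)) :
    (evalState t).1 (frameTerm x y) = ((‖x t‖ ^ 2 * ‖y t‖ ^ 2 : ℝ) : ℂ) := by
  rw [frameTerm, evalState_coe]
  simp only [ZeroAtInftyContinuousMap.mul_apply, ZeroAtInftyContinuousMap.star_apply]
  push_cast
  rw [← Complex.conj_mul', ← Complex.conj_mul', Complex.star_def]
  ring

theorem evalState_innerSelf (t : K) (x : C₀(K, ℂ)) :
    (evalState t).1 (innerSelf x) = ((‖x t‖ ^ 2 : ℝ) : ℂ) := by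
  rw [innerSelf, evalState_coe, Complex.ofReal_pow]
  exact Complex.conj_mul' _

theorem IsFrame.countable_and_nonempty_setOf_apply_ne_zero [R1Space K] [LocallyCompactSpace K]
    {J : Type*} {u : J → C₀(K, ℂ)} (hu : IsFrame u) (t : K) :
    {j | u j t ≠ 0}.Countable ∧ {j | u j t ≠ 0}.Nonempty := by
  obtain ⟨c, hc, hbound⟩ := hu.exists_isScalarLowerFrameBound
  obtain ⟨x, hx, -⟩ := exists_eqOn_one_of_isCompact ℂ (isCompact_singleton (x := t))
  obtain ⟨s, hs, hle⟩ := hbound (evalState t) x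
  have hxt : x t = 1 := hx (mem_singleton t)
  simp only [evalState_frameTerm, evalState_innerSelf, hxt] at hs hle
  have hsupp : Function.support (fun j => ((‖(1 : ℂ)‖ ^ 2 * ‖u j t‖ ^ 2 : ℝ) : ℂ)) =
      {j | u j t ≠ 0} := by
    ext j
    simp
  refine ⟨hsupp ▸ hs.summable.countable_support, ?_⟩
  by_contra! hempty
  rw [← hsupp, Function.support_eq_empty_iff] at hempty
  rw [hempty] at hs
  rw [hs.unique hasSum_zero] at hle
  have hc0 : (c : ℂ) ≤ 0 := by simpa using hle
  exact hc.not_ge (by exact_mod_cast hc0)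

theorem ClassIV.not_isFrame [R1Space K] [LocallyCompactSpace K] {P : Type*} [TopologicalSpace P]
    (hP : ClassIV P) {i : P → K} (hi : IsClosedEmbedding i) {J : Type*} (u : J → C₀(K, ℂ)) :
    ¬ IsFrame u := fun hu =>
  iUnion_ne_univ_of_forall_countable hP.not_sigmaCompactSpace hP.exists_mapClusterPt
    (U := fun j => i ⁻¹' Function.support (u j))
    (fun j => (u j).1.continuous.isOpen_support.preimage hi.continuous)
    (fun j => isSigmaCompact_preimage_of_isClosedEmbedding hi (isSigmaCompact_support (u j)))
    (fun p => (hu.countable_and_nonempty_setOf_apply_ne_zero (i p)).1)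
    (iUnion_eq_univ_iff.2 fun p => (hu.countable_and_nonempty_setOf_apply_ne_zero (i p)).2)

end NoFrames

/-! ### The indicator function of a clopen summand -/

section Indicator

variable {P₁ P₂ : Type*} [TopologicalSpace P₁] [TopologicalSpace P₂]

theorem support_indicatorInl : Function.support (indicatorInl P₁ P₂) = range Sum.inl := by
  ext (t | t) <;> simp [indicatorInl]

theorem not_tendsto_indicatorInl_cocompact_zero [NoncompactSpace P₁] :
    ¬ Tendsto (indicatorInl P₁ P₂) (cocompact (P₁ ⊕ P₂)) (𝓝 0) := fun h => by
  have hone : Tendsto (fun _ : P₁ => (1 : ℂ)) (cocompact P₁) (𝓝 0) :=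
    h.comp IsClosedEmbedding.inl.tendsto_cocompact
  exact one_ne_zero (tendsto_nhds_unique tendsto_const_nhds hone)

theorem ClassIV.isCompact_closure_inter_range_inl (h₁ : ClassIV P₁) {S : Set (P₁ ⊕ P₂)}
    (hS : IsSigmaCompact S) : IsCompact (closure (S ∩ range Sum.inl)) := by
  rw [← image_preimage_eq_inter_range, isCompact_closure_image_iff_of_isClosedEmbedding .inl]
  exact h₁.2.2.2 _ (isSigmaCompact_preimage_of_isClosedEmbedding .inl hS)

end Indicator

end CStarFrames

open CStarFrames in
theorem mainTheorem6_general {P₁ : Type*} {P₂ : Type*} [TopologicalSpace P₁] [TopologicalSpace P₂]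
    [LocallyCompactSpace P₂] [T2Space P₂] (h₁ : ClassIV P₁) :
    (¬ ClassIV P₂ → ¬ CompactSpace P₂ → ClassIII (P₁ ⊕ P₂)) ∧
    IsAdjointable (mulOperator (indicatorInl P₁ P₂)) ∧
    ¬ IsACompact (mulOperator (indicatorInl P₁ P₂)) ∧
    IsOuterTotallyBounded
      (mulOperator (indicatorInl P₁ P₂) '' Metric.closedBall (0 : C₀(P₁ ⊕ P₂, ℂ)) 1) ∧
    ∀ (J : Type*) (x : J → C₀(P₁ ⊕ P₂, ℂ)), ¬ IsFrame x := by
  have : LocallyCompactSpace P₁ := h₁.1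
  have : T2Space P₁ := h₁.2.1
  have : NoncompactSpace P₁ := h₁.noncompactSpace
  have : LocallyCompactSpace (P₁ ⊕ P₂) := locallyCompactSpace_sum
  refine ⟨fun hIV hc => h₁.classIII_sum (exists_isSigmaCompact_not_isCompact_closure hIV hc),
    isAdjointable_mulOperator _,
    mt tendsto_cocompact_zero_of_isACompact_mulOperator not_tendsto_indicatorInl_cocompact_zero,
    isOuterTotallyBounded_image_mulOperator (fun S hS => ?_) Metric.isBounded_closedBall,
    fun J x => h₁.not_isFrame IsClosedEmbedding.inl x⟩
  rw [support_indicatorInl]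
  exact h₁.isCompact_closure_inter_range_inl hS

theorem mainTheorem6 {P₁ : Type*} {P₂ : Type*} [TopologicalSpace P₁] [TopologicalSpace P₂]
    (h₁ : CStarFrames.ClassIV P₁)
    (h₂ : CStarFrames.ClassI P₂ ∨ CStarFrames.ClassII P₂ ∨ CStarFrames.ClassIII P₂) :
    (¬ CompactSpace P₂ → CStarFrames.ClassIII (P₁ ⊕ P₂)) ∧
    CStarFrames.IsAdjointable
      (CStarFrames.mulOperator (CStarFrames.indicatorInl P₁ P₂)) ∧
    ¬ CStarFrames.IsACompact
      (CStarFrames.mulOperator (CStarFrames.indicatorInl P₁ P₂)) ∧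
    CStarFrames.IsOuterTotallyBounded
      (CStarFrames.mulOperator (CStarFrames.indicatorInl P₁ P₂) ''
        Metric.closedBall (0 : C₀(P₁ ⊕ P₂, ℂ)) 1) ∧
    ∀ (J : Type*) (x : J → C₀(P₁ ⊕ P₂, ℂ)), ¬ CStarFrames.IsFrame x := by
  obtain ⟨_, _⟩ : LocallyCompactSpace P₂ ∧ T2Space P₂ := by
    rcases h₂ with h | h | h <;> exact ⟨h.1, h.2.1⟩
  exact (mainTheorem6_general h₁).imp_left fun h =>
    h (CStarFrames.not_classIV_of_classI_or_classII_or_classIII h₂)
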